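/- Let $\mathit{Atm}_0$ be a countably infinite set of atoms and $\mathit{Val}$ a finite set of output values. Formulas are given by $$\varphi ::= p \mid \mathsf{t}(x) \mid \neg\varphi \mid \varphi\wedge\varphi \mid \Box_I\varphi \mid \Box_F\varphi \qquad (p\in \mathit{Atm}_0,\ x\in \mathit{Val}),$$ with $\vee,\to,\leftrightarrow$ the usual abbreviations. A multi-classifier model (MCM) is a pair $\Gamma=(S,\Phi)$ with $S\subseteq 2^{\mathit{Atm}_0}$ and $\Phi\subseteq \mathit{Val}^S$. For $s\in S$ and $f\in\Phi$: $(\Gamma,s,f)\models p$ iff $p\in s$; $(\Gamma,s,f)\models \mathsf{t}(x)$ iff $f(s)=x$; $\neg$ and $\wedge$ are interpreted as usual; $(\Gamma,s,f)\models\Box_I\varphi$ iff $(\Gamma,s',f)\models\varphi$ for all $s'\in S$; $(\Gamma,s,f)\models\Box_F\varphi$ iff $(\Gamma,s,f')\models\varphi$ for all $f'\in\Phi$. A formula $\varphi$ is valid relative to MCMs if $(\Gamma,s,f)\models\varphi$ for every MCM $\Gamma=(S,\Phi)$, every $s\in S$ and every $f\in\Phi$ (equivalently, $\neg\varphi$ is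 not satisfiable). The logic $\mathsf{WPLC}$ is the extension of classical propositional logic (all tautologies, modus ponens) by the following axioms and rule, where $\blacksquare\in\{\Box_I,\Box_F\}$, $p \in \mathit{Atm}_0$ and $x,y\in\mathit{Val}$: - $(\blacksquare\varphi\wedge\blacksquare(\varphi\to\psi))\to\blacksquare\psi$, $\ \blacksquare\varphi\to\varphi$, $\ \blacksquare\varphi\to\blacksquare\blacksquare\varphi$, $\ \neg\blacksquare\varphi\to\blacksquare\neg\blacksquare\varphi$; - $\Box_F\Box_I\varphi\leftrightarrow\Box_I\Box_F\varphi$; - $\bigvee_{x\in \mathit{Val}}\mathsf{t}(x)$, and $\mathsf{t}(x)\to\neg\mathsf{t}(y)$ whenever $x\neq y$; - $p\to\Box_F p$ and $\neg p\to\Box_F\neg p$; - from $\varphi$ infer $\blacksquare\varphi$. Then $\mathsf{WPLC}$ is sound and complete relative to the class of MCMs: a formula $\varphi$ is a theorem of $\mathsf{WPLC}$ if and only if it is valid relative to MCMs. -/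

import Mathlib

namespace PLC

universe u v

/-- The two modalities: `inp` indexes `□_I` (all input instances, for the actual classifier),
`fn` indexes `□_F` (all classifiers, for the actual input instance). -/
inductive Modality : Type
  | inp
  | fn

/-- The modal language over input atoms `Atm` and output values `Val`:
`φ ::= p | t(x) | ¬φ | φ ∧ φ | □_I φ | □_F φ`. -/
inductive Formula (Atm : Type u) (Val : Type v) : Type (max u v)
  | atom (p : Atm) : Formula Atm Val
  | dec (x : Val) : Formula Atm Val
  | neg (φ : Formula Atm Val) : Formula Atm Val
  | and (φ ψ : Formula Atm Val) : Formula Atm Val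
  | box (m : Modality) (φ : Formula Atm Val) : Formula Atm Val

namespace Formula

variable {Atm : Type u} {Val : Type v}

/-- `φ ∨ ψ` abbreviates `¬(¬φ ∧ ¬ψ)`. -/
def or (φ ψ : Formula Atm Val) : Formula Atm Val := neg (and (neg φ) (neg ψ))

/-- `φ → ψ` abbreviates `¬(φ ∧ ¬ψ)`. -/
def imp (φ ψ : Formula Atm Val) : Formula Atm Val := neg (and φ (neg ψ))

/-- `φ ↔ ψ` abbreviates `(φ → ψ) ∧ (ψ → φ)`. -/
def iff (φ ψ : Formula Atm Val) : Formula Atm Val := and (imp φ ψ) (imp ψ φ)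

/-- Falsum, written with the atom `p` since the language has no constant for it. -/
def bot (p : Atm) : Formula Atm Val := and (atom p) (neg (atom p))

/-- `t(x₁) ∨ (t(x₂) ∨ (… ∨ (t(xₙ) ∨ ⊥)))` for a list `x₁, …, xₙ` of values. -/
def decDisj (p : Atm) : List Val → Formula Atm Val
  | [] => bot p
  | x :: l => or (dec x) (decDisj p l)

/-- `φ` is an instance, in the modal language, of a tautology of classical propositional logic:
every assignment of truth values to formulas that respects `¬` and `∧` (and is arbitrary on
atoms and on boxed formulas) makes `φ` true. -/
def IsTautology (φ : Formula Atm Val) : Prop :=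
  ∀ e : Formula Atm Val → Prop,
    (∀ ψ, e (neg ψ) ↔ ¬ e ψ) → (∀ ψ χ, e (and ψ χ) ↔ (e ψ ∧ e χ)) → e φ

end Formula

/-- A multi-classifier model `(S, Φ)`: a set `S` of input instances, each a set of atoms, and
a set `Φ` of classifiers, each a function from `S` to `Val`. -/
structure MCM (Atm : Type u) (Val : Type v) : Type (max u v) where
  S : Set (Set Atm)
  Φ : Set (S → Val)

namespace MCM

variable {Atm : Type u} {Val : Type v}

/-- Truth of a formula at the pointed model `(Γ, s, f)` with `s ∈ S` and `f ∈ Φ`. -/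
def Sat (Γ : MCM Atm Val) : Formula Atm Val → Γ.S → Γ.Φ → Prop
  | .atom p, s, _ => p ∈ s.1
  | .dec x, s, f => f.1 s = x
  | .neg φ, s, f => ¬ Γ.Sat φ s f
  | .and φ ψ, s, f => Γ.Sat φ s f ∧ Γ.Sat ψ s f
  | .box .inp φ, _, f => ∀ s' : Γ.S, Γ.Sat φ s' f
  | .box .fn φ, s, _ => ∀ f' : Γ.Φ, Γ.Sat φ s f'

/-- Satisfiability relative to the class of all multi-classifier models. -/
def Satisfiable (φ : Formula Atm Val) : Prop :=
  ∃ (Γ : MCM Atm Val) (s : Γ.S) (f : Γ.Φ), Γ.Sat φ s f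

/-- Validity relative to the class of all multi-classifier models. -/
def Valid (φ : Formula Atm Val) : Prop := ¬ Satisfiable φ.neg

end MCM

open Formula in
/-- Theoremhood in the logic WPLC: classical propositional logic (all tautologies and modus
ponens) with the S5 axioms and necessitation for both modalities, commutation of the modalities,
"at least one" and "at most one" decision value, and independence of the input atoms from
the classifier. -/
inductive WPLC {Atm : Type u} {Val : Type v} : Formula Atm Val → Prop
  | taut {φ : Formula Atm Val} (h : φ.IsTautology) : WPLC φ
  | mp {φ ψ : Formula Atm Val} (h₁ : WPLC (imp φ ψ)) (h₂ : WPLC φ) : WPLC ψ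
  | axK (m : Modality) (φ ψ : Formula Atm Val) :
      WPLC (imp (and (box m φ) (box m (imp φ ψ))) (box m ψ))
  | axT (m : Modality) (φ : Formula Atm Val) : WPLC (imp (box m φ) φ)
  | ax4 (m : Modality) (φ : Formula Atm Val) : WPLC (imp (box m φ) (box m (box m φ)))
  | ax5 (m : Modality) (φ : Formula Atm Val) :
      WPLC (imp (neg (box m φ)) (box m (neg (box m φ))))
  | comm (φ : Formula Atm Val) : WPLC (iff (box .fn (box .inp φ)) (box .inp (box .fn φ)))
  | atLeast (p : Atm) (l : List Val) (h : ∀ x : Val, x ∈ l) : WPLC (decDisj p l)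
  | atMost (x y : Val) (h : x ≠ y) : WPLC (imp (dec x) (neg (dec y)))
  | indepPos (p : Atm) : WPLC (imp (atom p) (box .fn (atom p)))
  | indepNeg (p : Atm) : WPLC (imp (neg (atom p)) (box .fn (neg (atom p))))
  | nec (m : Modality) {φ : Formula Atm Val} (h : WPLC φ) : WPLC (box m φ)

end PLC

namespace PLC

open Formula

variable {Atm : Type*} {Val : Type*}

/-! ### Soundness -/

namespace MCM

variable (Γ : MCM Atm Val) (s : Γ.S) (f : Γ.Φ)

/-! Soundness is an induction on derivations. Completeness starts from the canonical frame of
maximal theories, where both relations are equivalences and the commutation axiom makes them commute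
(`Acc.fn_inp_comm`). A component of this frame need not be a product, since an `inp`-class and an
`fn`-class may meet in several worlds; `exists_product_unravelling` covers it by a genuine grid
inputs × classifiers. Atoms are constant along `fn`, so each input has a well-defined set of atoms.
Distinct inputs may still agree on all atoms. As only finitely many atoms occur in the given
formula, the remaining ones can serve as names separating the inputs (`exists_injective_naming`);
this changes no subformula's truth value. -/

theorem sat_neg (φ : Formula Atm Val) : Γ.Sat φ.neg s f ↔ ¬ Γ.Sat φ s f := Iff.rfl

theorem sat_and (φ ψ : Formula Atm Val) :
    Γ.Sat (φ.and ψ) s f ↔ Γ.Sat φ s f ∧ Γ.Sat ψ s f := Iff.rfl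

theorem sat_imp (φ ψ : Formula Atm Val) :
    Γ.Sat (imp φ ψ) s f ↔ (Γ.Sat φ s f → Γ.Sat ψ s f) := by
  simp only [imp, sat_neg, sat_and]; tauto

theorem sat_iff (φ ψ : Formula Atm Val) :
    Γ.Sat (Formula.iff φ ψ) s f ↔ (Γ.Sat φ s f ↔ Γ.Sat ψ s f) := by
  simp only [Formula.iff, sat_and, sat_imp]; tauto

theorem sat_inp (φ : Formula Atm Val) :
    Γ.Sat (.box .inp φ) s f ↔ ∀ s' : Γ.S, Γ.Sat φ s' f := Iff.rfl

theorem sat_fn (φ : Formula Atm Val) :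
    Γ.Sat (.box .fn φ) s f ↔ ∀ f' : Γ.Φ, Γ.Sat φ s f' := Iff.rfl

theorem sat_decDisj (p : Atm) (l : List Val) (h : f.1 s ∈ l) : Γ.Sat (decDisj p l) s f := by
  induction l with
  | nil => simp at h
  | cons x l ih =>
    simp only [decDisj, Formula.or, sat_neg, sat_and]
    rintro ⟨h1, h2⟩
    rcases List.mem_cons.1 h with h | h
    · exact h1 h
    · exact h2 (ih h)

end MCM

theorem WPLC.sat {φ : Formula Atm Val} (h : WPLC φ) (Γ : MCM Atm Val) :
    ∀ (s : Γ.S) (f : Γ.Φ), Γ.Sat φ s f := by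
  induction h with
  | taut h => exact fun s f => h (fun ψ => Γ.Sat ψ s f) (fun _ => Iff.rfl) (fun _ _ => Iff.rfl)
  | mp _ _ ih₁ ih₂ => exact fun s f => (Γ.sat_imp s f _ _).1 (ih₁ s f) (ih₂ s f)
  | axK m φ ψ =>
    intro s f
    cases m <;> simp only [MCM.sat_imp, MCM.sat_and, MCM.sat_inp, MCM.sat_fn] <;>
      exact fun h a => h.2 a (h.1 a)
  | axT m φ =>
    intro s f
    cases m <;> simp only [MCM.sat_imp, MCM.sat_inp, MCM.sat_fn] <;> exact fun h => h _
  | ax4 m φ =>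
    intro s f
    cases m <;> simp only [MCM.sat_imp, MCM.sat_inp, MCM.sat_fn] <;> exact fun h _ => h
  | ax5 m φ =>
    intro s f
    cases m <;> simp only [MCM.sat_imp, MCM.sat_neg, MCM.sat_inp, MCM.sat_fn] <;>
      exact fun h _ => h
  | comm φ =>
    intro s f
    simp only [MCM.sat_iff, MCM.sat_inp, MCM.sat_fn]
    exact forall_comm
  | atLeast p l h => exact fun s f => Γ.sat_decDisj s f p l (h _)
  | atMost x y h =>
    intro s f
    rw [MCM.sat_imp, MCM.sat_neg]
    exact fun h₁ h₂ => h (h₁.symm.trans h₂)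
  | indepPos p =>
    intro s f
    rw [MCM.sat_imp, MCM.sat_fn]
    exact fun h _ => h
  | indepNeg p =>
    intro s f
    rw [MCM.sat_imp, MCM.sat_fn]
    exact fun h _ => h
  | nec m _ ih =>
    intro s f
    cases m
    · exact fun s' => ih s' f
    · exact fun f' => ih s f'

theorem WPLC.valid {φ : Formula Atm Val} (h : WPLC φ) : MCM.Valid φ :=
  fun ⟨Γ, s, f, hs⟩ => hs (h.sat Γ s f)

/-! ### Theories and maximal theories -/

/-- A set of formulas containing all theorems and closed under modus ponens. -/
structure IsTheory (T : Set (Formula Atm Val)) : Prop where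
  thm : ∀ {φ}, WPLC φ → φ ∈ T
  mp : ∀ {φ ψ}, imp φ ψ ∈ T → φ ∈ T → ψ ∈ T

/-- A theory that decides every formula consistently. -/
structure IsMaximal (M : Set (Formula Atm Val)) : Prop extends IsTheory M where
  neg_iff : ∀ φ, neg φ ∈ M ↔ φ ∉ M

theorem isTheory_wplc : IsTheory {φ : Formula Atm Val | WPLC φ} := ⟨id, WPLC.mp⟩

theorem IsTheory.adjoin {T : Set (Formula Atm Val)} (hT : IsTheory T) (φ : Formula Atm Val) :
    IsTheory {ψ | imp φ ψ ∈ T} where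
  thm {ψ} h := hT.mp (hT.thm (.taut fun e hn ha => by simp only [imp, hn, ha]; tauto))
    (hT.thm h)
  mp {ψ χ} h₁ h₂ := by
    have h : WPLC (imp (imp φ (imp ψ χ)) (imp (imp φ ψ) (imp φ χ))) :=
      .taut fun e hn ha => by simp only [imp, hn, ha]; tauto
    exact hT.mp (hT.mp (hT.thm h) h₁) h₂

/-- Take `M` maximal among the theories extending `T` and omitting `φ`. Adjoining any `ψ ∉ M` must
produce `φ`, so `M` contains `ψ → φ`; if `ψ` and `¬ψ` were both missing, case distinction would put
`φ` in `M`. -/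
theorem IsTheory.exists_isMaximal {T : Set (Formula Atm Val)} (hT : IsTheory T)
    {φ : Formula Atm Val} (hφ : φ ∉ T) : ∃ M, T ⊆ M ∧ IsMaximal M ∧ φ ∉ M := by
  obtain ⟨M, hTM, ⟨⟨hM, hMφ⟩, hmax⟩⟩ := zorn_subset_nonempty
    {U : Set (Formula Atm Val) | IsTheory U ∧ φ ∉ U} (by
      intro c hc hchain ⟨U₀, hU₀⟩
      refine ⟨⋃₀ c, ⟨⟨fun h => ⟨U₀, hU₀, (hc hU₀).1.thm h⟩, ?_⟩, ?_⟩,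
        fun _ => Set.subset_sUnion_of_mem⟩
      · rintro ψ χ ⟨U, hU, h₁⟩ ⟨U', hU', h₂⟩
        rcases hchain.total hU hU' with h | h
        · exact ⟨U', hU', (hc hU').1.mp (h h₁) h₂⟩
        · exact ⟨U, hU, (hc hU).1.mp h₁ (h h₂)⟩
      · rintro ⟨U, hU, h⟩
        exact (hc hU).2 h) T ⟨hT, hφ⟩
  have key : ∀ ψ, ψ ∉ M → imp ψ φ ∈ M := by
    intro ψ hψ
    by_contra h
    have hsub : M ⊆ {χ | imp ψ χ ∈ M} := fun χ hχ =>
      hM.mp (hM.thm (.taut fun e hn ha => by simp only [imp, hn, ha]; tauto)) hχ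
    exact hψ (hmax ⟨hM.adjoin ψ, h⟩ hsub
      (hM.thm (.taut fun e hn ha => by simp only [imp, hn, ha]; tauto)))
  refine ⟨M, hTM, ⟨hM, fun ψ => ⟨fun h₁ h₂ => hMφ ?_, fun h₁ => ?_⟩⟩, hMφ⟩
  · have h : WPLC (imp (neg ψ) (imp ψ φ)) :=
      .taut fun e hn ha => by simp only [imp, hn, ha]; tauto
    exact hM.mp (hM.mp (hM.thm h) h₁) h₂
  · by_contra h₂
    have h : WPLC (imp (imp ψ φ) (imp (imp (neg ψ) φ) φ)) :=
      .taut fun e hn ha => by simp only [imp, hn, ha]; tauto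
    exact hMφ (hM.mp (hM.mp (hM.thm h) (key _ h₁)) (key _ h₂))

namespace IsMaximal

variable {M : Set (Formula Atm Val)} (hM : IsMaximal M)
include hM

theorem and_iff (φ ψ : Formula Atm Val) : φ.and ψ ∈ M ↔ φ ∈ M ∧ ψ ∈ M := by
  refine ⟨fun h => ⟨hM.mp (hM.thm (.taut ?_)) h, hM.mp (hM.thm (.taut ?_)) h⟩,
    fun h => hM.mp (hM.mp (hM.thm (.taut ?_)) h.1) h.2⟩ <;>
  · intro e hn ha
    simp only [imp, hn, ha]
    tauto

theorem imp_iff (φ ψ : Formula Atm Val) : imp φ ψ ∈ M ↔ (φ ∈ M → ψ ∈ M) := by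
  simp only [imp, hM.neg_iff, hM.and_iff]; tauto

theorem iff_iff (φ ψ : Formula Atm Val) : Formula.iff φ ψ ∈ M ↔ (φ ∈ M ↔ ψ ∈ M) := by
  simp only [Formula.iff, hM.and_iff, hM.imp_iff]; tauto

theorem of_thm_imp {φ ψ : Formula Atm Val} (h : WPLC (imp φ ψ)) (hφ : φ ∈ M) : ψ ∈ M :=
  hM.mp (hM.thm h) hφ

theorem box_mp {m : Modality} {φ ψ : Formula Atm Val} (h₁ : box m (imp φ ψ) ∈ M)
    (h₂ : box m φ ∈ M) : box m ψ ∈ M :=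
  hM.of_thm_imp (.axK m φ ψ) ((hM.and_iff _ _).2 ⟨h₂, h₁⟩)

theorem exists_dec_mem_of_decDisj (p : Atm) (l : List Val) (h : decDisj p l ∈ M) :
    ∃ x, dec x ∈ M := by
  induction l with
  | nil => simp [decDisj, bot, hM.and_iff, hM.neg_iff] at h
  | cons x l ih =>
    simp only [decDisj, Formula.or, hM.and_iff, hM.neg_iff] at h
    by_cases hx : dec x ∈ M
    · exact ⟨x, hx⟩
    · exact ih (by tauto)

theorem existsUnique_dec [Nonempty Atm] [Finite Val] : ∃! x, dec x ∈ M := by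
  obtain ⟨l, hl⟩ : ∃ l : List Val, ∀ x, x ∈ l :=
    have := Fintype.ofFinite Val
    ⟨Finset.univ.toList, by simp⟩
  obtain ⟨x, hx⟩ := hM.exists_dec_mem_of_decDisj (Classical.arbitrary Atm) l
    (hM.thm (.atLeast _ l hl))
  refine ⟨x, hx, fun y hy => ?_⟩
  by_contra hne
  exact (hM.neg_iff _).1 (hM.of_thm_imp (.atMost y x hne) hy) hx

end IsMaximal

/-! ### The canonical frame -/

variable (Atm Val) in
/-- Worlds of the canonical frame. -/
abbrev World : Type _ := {M : Set (Formula Atm Val) // IsMaximal M}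

/-- Canonical accessibility relation of a modality. -/
def Acc (m : Modality) (M N : World Atm Val) : Prop := ∀ φ, box m φ ∈ M.1 → φ ∈ N.1

theorem isTheory_box (m : Modality) (M : World Atm Val) : IsTheory {φ | box m φ ∈ M.1} :=
  ⟨fun h => M.2.thm (h.nec m), M.2.box_mp⟩

/-- Axiom 4 carries boxes forward and axiom 5 carries their negations; with T this makes `Acc m` an
equivalence relation. -/
theorem Acc.box_mem_iff {m : Modality} {M N : World Atm Val} (h : Acc m M N)
    (φ : Formula Atm Val) : box m φ ∈ M.1 ↔ box m φ ∈ N.1 := by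
  refine ⟨fun hφ => h _ (M.2.of_thm_imp (.ax4 m φ) hφ), fun hφ => ?_⟩
  by_contra hn
  exact (N.2.neg_iff _).1 (h _ (M.2.of_thm_imp (.ax5 m φ) ((M.2.neg_iff _).2 hn))) hφ

theorem Acc.refl (m : Modality) (M : World Atm Val) : Acc m M M :=
  fun φ => M.2.of_thm_imp (.axT m φ)

theorem Acc.symm {m : Modality} {M N : World Atm Val} (h : Acc m M N) : Acc m N M :=
  fun φ hφ => Acc.refl m M φ ((h.box_mem_iff φ).2 hφ)

theorem Acc.trans {m : Modality} {M N K : World Atm Val} (h₁ : Acc m M N) (h₂ : Acc m N K) :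
    Acc m M K :=
  fun φ hφ => h₂ φ ((h₁.box_mem_iff φ).1 hφ)

theorem box_mem_iff_forall_acc (m : Modality) (M : World Atm Val) (φ : Formula Atm Val) :
    box m φ ∈ M.1 ↔ ∀ N, Acc m M N → φ ∈ N.1 := by
  refine ⟨fun h N hN => hN φ h, fun h => ?_⟩
  by_contra hn
  obtain ⟨N, hMN, hN, hφ⟩ := (isTheory_box m M).exists_isMaximal hn
  exact hφ (h ⟨N, hN⟩ fun _ hψ => hMN hψ)

theorem Acc.atom_mem_iff {M N : World Atm Val} (h : Acc .fn M N) (p : Atm) :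
    atom p ∈ M.1 ↔ atom p ∈ N.1 := by
  refine ⟨fun hp => h _ (M.2.of_thm_imp (.indepPos p) hp), fun hp => ?_⟩
  by_contra hn
  exact (N.2.neg_iff _).1 (h _ (M.2.of_thm_imp (.indepNeg p) ((M.2.neg_iff _).2 hn))) hp

theorem Acc.fn_inp_comm [Nonempty Atm] {M N K : World Atm Val} (h₁ : Acc .fn M N) (h₂ : Acc .inp N K) :
    ∃ L, Acc .inp M L ∧ Acc .fn L K := by
  -- From `□_I ¬ψ` in `M`, Brouwer's principle gives `□_I □_F ¬□_F ψ`; commuting the boxes and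
  -- passing through `N` puts `¬□_F ψ` in `K`.
  have compatible : ∀ ψ, box .fn ψ ∈ K.1 → box .inp (neg ψ) ∉ M.1 := by
    intro ψ hK hM
    have brouwer : WPLC (imp (neg ψ) (box .fn (neg (box .fn ψ)))) := by
      have h : WPLC (imp (imp (box .fn ψ) ψ)
          (imp (imp (neg (box .fn ψ)) (box .fn (neg (box .fn ψ))))
            (imp (neg ψ) (box .fn (neg (box .fn ψ)))))) :=
        .taut fun e hn ha => by simp only [imp, hn, ha]; tauto
      exact (h.mp (.axT _ _)).mp (.ax5 _ _)
    have h := M.2.box_mp (M.2.thm (brouwer.nec .inp)) hM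
    have h := ((M.2.iff_iff _ _).1 (M.2.thm (.comm _))).2 h
    exact (K.2.neg_iff _).1 (h₂ _ (h₁ _ h)) hK
  -- This is the theory that `L` must extend: the consequences of everything boxed by `□_I` in `M`
  -- or by `□_F` in `K`.
  have hT : IsTheory {χ | ∃ ψ, box .fn ψ ∈ K.1 ∧ box .inp (imp ψ χ) ∈ M.1} := by
    refine ⟨fun {χ} h => ⟨χ, K.2.thm (h.nec _), M.2.thm (.nec _ (.taut ?_))⟩, ?_⟩
    · intro e hn ha
      simp only [imp, hn, ha]
      tauto
    · rintro χ ξ ⟨ψ₁, hK₁, hM₁⟩ ⟨ψ₂, hK₂, hM₂⟩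
      have hK : WPLC (imp ψ₁ (imp ψ₂ (ψ₁.and ψ₂))) :=
        .taut fun e hn ha => by simp only [imp, hn, ha]; tauto
      have hM : WPLC (imp (imp ψ₁ (imp χ ξ)) (imp (imp ψ₂ χ) (imp (ψ₁.and ψ₂) ξ))) :=
        .taut fun e hn ha => by simp only [imp, hn, ha]; tauto
      exact ⟨ψ₁.and ψ₂, K.2.box_mp (K.2.box_mp (K.2.thm (hK.nec _)) hK₁) hK₂,
        M.2.box_mp (M.2.box_mp (M.2.thm (hM.nec _)) hM₁) hM₂⟩
  let p : Atm := Classical.arbitrary Atm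
  have hbot : bot p ∉ {χ | ∃ ψ, box .fn ψ ∈ K.1 ∧ box .inp (imp ψ χ) ∈ M.1} := by
    rintro ⟨ψ, hK, hM⟩
    have h : WPLC (imp (imp ψ (bot p)) (neg ψ)) :=
      .taut fun e hn ha => by simp only [imp, bot, hn, ha]; tauto
    exact compatible ψ hK (M.2.box_mp (M.2.thm (h.nec _)) hM)
  obtain ⟨L, hTL, hL, -⟩ := hT.exists_isMaximal hbot
  have hrefl (φ : Formula Atm Val) : WPLC (imp φ φ) :=
    .taut fun e hn ha => by simp only [imp, hn, ha]; tauto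
  refine ⟨⟨L, hL⟩, fun φ hφ => hTL ⟨imp φ φ, K.2.thm ((hrefl φ).nec _), ?_⟩,
    Acc.symm fun φ hφ => hTL ⟨φ, hφ, M.2.thm ((hrefl φ).nec _)⟩⟩
  have h : WPLC (imp φ (imp (imp φ φ) φ)) :=
    .taut fun e hn ha => by simp only [imp, hn, ha]; tauto
  exact M.2.box_mp (M.2.thm (h.nec _)) hφ

theorem Acc.inp_fn_comm [Nonempty Atm] {M N K : World Atm Val} (h₁ : Acc .inp M N)
    (h₂ : Acc .fn N K) : ∃ L, Acc .fn M L ∧ Acc .inp L K :=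
  let ⟨L, hL₁, hL₂⟩ := Acc.fn_inp_comm h₂.symm h₁.symm
  ⟨L, hL₂.symm, hL₁.symm⟩

/-! ### Unravelling a component of the canonical frame into a product -/

/-- Every component of the canonical frame is a bounded morphic image of a product, in which the
two coordinates are indexed by worlds paired with sets of formulas. -/
theorem exists_product_unravelling [Nonempty Atm] (W : World Atm Val) :
    ∃ g : ({M // Acc .inp W M} × Set (Formula Atm Val)) →
        ({N // Acc .fn W N} × Set (Formula Atm Val)) → World Atm Val,
      (∃ x y, g x y = W) ∧ (∀ x y, Acc .fn x.1.1 (g x y)) ∧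
      (∀ x y, ∀ K, Acc .inp (g x y) K ↔ ∃ x', g x' y = K) ∧
      (∀ x y, ∀ K, Acc .fn (g x y) K ↔ ∃ y', g x y' = K) := by
  classical
  have hcell (M : {M // Acc .inp W M}) (N : {N // Acc .fn W N}) :
      ∃ K, Acc .fn M.1 K ∧ Acc .inp K N.1 := Acc.inp_fn_comm M.2.symm N.2
  -- `σ` maps sets of formulas onto the cell of `M` and `N`; sets that are not worlds of the cell go
  -- to the default `K₀`.
  have hsurj (M : {M // Acc .inp W M}) (N : {N // Acc .fn W N}) :
      ∃ σ : Set (Formula Atm Val) → World Atm Val,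
        (∀ k, Acc .fn M.1 (σ k) ∧ Acc .inp (σ k) N.1) ∧
        ∀ K : World Atm Val, Acc .fn M.1 K → Acc .inp K N.1 → σ K.1 = K := by
    obtain ⟨K₀, hK₀⟩ := hcell M N
    refine ⟨fun k => if h : ∃ hk : IsMaximal k, Acc .fn M.1 ⟨k, hk⟩ ∧ Acc .inp ⟨k, hk⟩ N.1
      then ⟨k, h.1⟩ else K₀, fun k => ?_, fun K h₁ h₂ => dif_pos ⟨K.2, h₁, h₂⟩⟩
    dsimp only
    split_ifs with h
    · exact h.2
    · exact hK₀
  choose σ hσ hσK using hsurj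
  -- With either argument fixed, `symmDiff` is a bijection in the other, so every row and every
  -- column runs through all worlds of each cell it meets.
  refine ⟨fun x y => σ x.1 y.1 (symmDiff x.2 y.2), ?_, fun x y => (hσ _ _ _).1, ?_, ?_⟩
  · refine ⟨(⟨W, .refl _ W⟩, W.1), (⟨W, .refl _ W⟩, ⊥), ?_⟩
    simpa only [symmDiff_bot] using hσK ⟨W, .refl _ W⟩ ⟨W, .refl _ W⟩ W (.refl _ W) (.refl _ W)
  · refine fun x y K => ⟨fun h => ?_, ?_⟩
    · have hKN : Acc .inp K y.1.1 := h.symm.trans (hσ _ _ _).2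
      obtain ⟨M, hM₁, hM₂⟩ := Acc.fn_inp_comm y.1.2 hKN.symm
      refine ⟨(⟨M, hM₁⟩, symmDiff K.1 y.2), ?_⟩
      simpa using hσK ⟨M, hM₁⟩ y.1 K hM₂ hKN
    · rintro ⟨x', rfl⟩
      exact (hσ _ _ _).2.trans (hσ _ _ _).2.symm
  · refine fun x y K => ⟨fun h => ?_, ?_⟩
    · have hMK : Acc .fn x.1.1 K := (hσ _ _ _).1.trans h
      obtain ⟨N, hN₁, hN₂⟩ := Acc.inp_fn_comm x.1.2 hMK
      refine ⟨(⟨N, hN₁⟩, symmDiff x.2 K.1), ?_⟩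
      simpa using hσK x.1 ⟨N, hN₁⟩ K hMK hN₂.symm
    · rintro ⟨y', rfl⟩
      exact (hσ _ _ _).1.symm.trans (hσ _ _ _).1

/-! ### Naming inputs by fresh atoms -/

namespace Formula

/-- The atoms occurring in a formula. -/
def atoms : Formula Atm Val → Set Atm
  | atom p => {p}
  | dec _ => ∅
  | neg φ => φ.atoms
  | and φ ψ => φ.atoms ∪ ψ.atoms
  | box _ φ => φ.atoms

theorem finite_atoms (φ : Formula Atm Val) : φ.atoms.Finite := by
  induction φ with
  | atom p => exact Set.finite_singleton p
  | dec x => exact Set.finite_empty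
  | neg φ ih => exact ih
  | and φ ψ ih₁ ih₂ => exact ih₁.union ih₂
  | box m φ ih => exact ih

/-- A Gödel numbering of formulas induced by numberings of atoms and values. -/
def code (a : Atm → ℕ) (v : Val → ℕ) : Formula Atm Val → ℕ
  | atom p => Nat.pair 0 (a p)
  | dec x => Nat.pair 1 (v x)
  | neg φ => Nat.pair 2 (code a v φ)
  | and φ ψ => Nat.pair 3 (Nat.pair (code a v φ) (code a v ψ))
  | box .inp φ => Nat.pair 4 (code a v φ)
  | box .fn φ => Nat.pair 5 (code a v φ)

theorem code_injective {a : Atm → ℕ} {v : Val → ℕ} (ha : a.Injective) (hv : v.Injective) :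
    (code a v).Injective := by
  intro φ
  induction φ with
  | atom p => rintro (_ | _ | _ | _ | ⟨_ | _, _⟩) <;> simp [code, ha.eq_iff]
  | dec x => rintro (_ | _ | _ | _ | ⟨_ | _, _⟩) <;> simp [code, hv.eq_iff]
  | neg φ ih =>
    rintro (_ | _ | _ | _ | ⟨_ | _, _⟩) <;> simp [code]
    exact @ih _
  | and φ ψ ih₁ ih₂ =>
    rintro (_ | _ | _ | _ | ⟨_ | _, _⟩) <;> simp [code]
    exact fun h₁ h₂ => ⟨ih₁ h₁, ih₂ h₂⟩
  | box m φ ih =>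
    cases m <;> rintro (_ | _ | _ | _ | ⟨_ | _, _⟩) <;> simp [code] <;> exact @ih _

instance [Countable Atm] [Countable Val] : Countable (Formula Atm Val) :=
  let ⟨_, ha⟩ := exists_injective_nat Atm
  let ⟨_, hv⟩ := exists_injective_nat Val
  (code_injective ha hv).countable

end Formula

/-- Pairs of sets over a countable type can be coded by sets of atoms with prescribed trace on a
finite set of atoms. -/
theorem exists_injective_naming {ι X : Type*} [Countable ι] [Infinite Atm] {P : Set Atm}
    (hP : P.Finite) (c : X → Set ι × Set ι) (hc : c.Injective) (t : X → Set Atm) :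
    ∃ V : X → Set Atm, V.Injective ∧ ∀ x, ∀ p ∈ P, p ∈ V x ↔ p ∈ t x := by
  have := hP.infinite_compl.to_subtype
  obtain ⟨n, hn⟩ := exists_injective_nat (ι ⊕ ι)
  let e : ι ⊕ ι → Atm := fun i => (Infinite.natEmbedding (Pᶜ : Set Atm) (n i)).1
  have he : e.Injective :=
    Subtype.val_injective.comp ((Infinite.natEmbedding (Pᶜ : Set Atm)).injective.comp hn)
  have heP (i) : e i ∉ P := (Infinite.natEmbedding (Pᶜ : Set Atm) (n i)).2
  -- Inside `P` the set follows `t x`; outside, it stores the code of `x`.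
  refine ⟨fun x => t x ∩ P ∪ e '' (Sum.inl '' (c x).1 ∪ Sum.inr '' (c x).2), ?_, ?_⟩
  · intro x y hxy
    have key (i) : i ∈ Sum.inl '' (c x).1 ∪ Sum.inr '' (c x).2 ↔
        i ∈ Sum.inl '' (c y).1 ∪ Sum.inr '' (c y).2 := by
      have h : e i ∈ _ ↔ e i ∈ _ := Set.ext_iff.1 hxy (e i)
      simpa only [Set.mem_union (e i), Set.mem_inter_iff, heP, and_false, false_or,
        he.mem_set_image] using h
    refine hc (Prod.ext (Set.ext fun i => ?_) (Set.ext fun i => ?_))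
    · simpa using key (.inl i)
    · simpa using key (.inr i)
  · intro x p hp
    have : p ∉ e '' (Sum.inl '' (c x).1 ∪ Sum.inr '' (c x).2) := by
      rintro ⟨i, -, rfl⟩
      exact heP i hp
    simp only [Set.mem_union p, Set.mem_inter_iff, hp, this, and_true, or_false]

/-! ### Completeness -/

/-- Every world of the canonical frame is realized, as far as a given formula is concerned, in
some multi-classifier model. -/
theorem exists_mcm_sat_iff [Countable Atm] [Infinite Atm] [Finite Val] (W : World Atm Val)
    (φ : Formula Atm Val) :
    ∃ (Γ : MCM Atm Val) (s : Γ.S) (f : Γ.Φ), Γ.Sat φ s f ↔ φ ∈ W.1 := by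
  obtain ⟨g, ⟨x₀, y₀, h₀⟩, hx, hinp, hfn⟩ := exists_product_unravelling W
  obtain ⟨V, hV, hVP⟩ := exists_injective_naming φ.finite_atoms
    (fun x : {M // Acc .inp W M} × Set (Formula Atm Val) => (x.1.1.1, x.2))
    (fun x y h => by
      rw [Prod.mk.injEq] at h
      exact Prod.ext (Subtype.ext (Subtype.ext h.1)) h.2)
    (fun x => {p | atom p ∈ x.1.1.1})
  choose d hd hd' using fun M : World Atm Val => M.2.existsUnique_dec
  let F : ({N // Acc .fn W N} × Set (Formula Atm Val)) → Set.range V → Val :=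
    fun y s => d (g s.2.choose y)
  -- Injectivity of `V` makes the chosen preimage equal to `x`.
  have hF (x y) : F y ⟨V x, x, rfl⟩ = d (g x y) := by
    have h := (⟨x, rfl⟩ : V x ∈ Set.range V)
    exact congrArg (fun x => d (g x y)) (hV h.choose_spec)
  let Γ : MCM Atm Val := ⟨Set.range V, Set.range F⟩
  -- The restriction on atoms is needed because fresh atoms carry names, not truth values from the
  -- worlds. Different `y` may give the same classifier, which is harmless since the claim holds for
  -- every `y`.
  have truth : ∀ ψ : Formula Atm Val, ψ.atoms ⊆ φ.atoms → ∀ x y,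
      Γ.Sat ψ ⟨V x, x, rfl⟩ ⟨F y, y, rfl⟩ ↔ ψ ∈ (g x y).1 := by
    intro ψ
    induction ψ with
    | atom p =>
      intro hp x y
      exact (hVP x p (hp rfl)).trans ((hx x y).atom_mem_iff p)
    | dec v =>
      intro _ x y
      change F y ⟨V x, x, rfl⟩ = v ↔ _
      rw [hF]
      exact ⟨fun h => h ▸ hd _, fun h => (hd' _ _ h).symm⟩
    | neg ψ ih =>
      intro hψ x y
      rw [MCM.sat_neg, ih hψ, (g x y).2.neg_iff]
    | and ψ χ ih₁ ih₂ =>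
      intro h x y
      rw [MCM.sat_and, ih₁ (Set.subset_union_left.trans h), ih₂ (Set.subset_union_right.trans h),
        (g x y).2.and_iff]
    | box m ψ ih =>
      intro hψ x y
      rw [box_mem_iff_forall_acc]
      cases m with
      | inp =>
        simp only [MCM.sat_inp, hinp, forall_exists_index, forall_apply_eq_imp_iff, ← ih hψ]
        exact ⟨fun h x' => h _, fun h ⟨_, x', hx'⟩ => by subst hx'; exact h x'⟩
      | fn =>
        simp only [MCM.sat_fn, hfn, forall_exists_index, forall_apply_eq_imp_iff, ← ih hψ]
        exact ⟨fun h y' => h _, fun h ⟨_, y', hy'⟩ => by subst hy'; exact h y'⟩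
  exact ⟨Γ, _, _, (truth φ subset_rfl x₀ y₀).trans (by rw [h₀])⟩

theorem MCM.Valid.wplc [Countable Atm] [Infinite Atm] [Finite Val] {φ : Formula Atm Val}
    (h : MCM.Valid φ) : WPLC φ := by
  by_contra hφ
  obtain ⟨M, -, hM, hφM⟩ := isTheory_wplc.exists_isMaximal hφ
  obtain ⟨Γ, s, f, hs⟩ := exists_mcm_sat_iff ⟨M, hM⟩ φ
  exact h ⟨Γ, s, f, fun hsat => hφM (hs.1 hsat)⟩

end PLC

theorem mainTheorem2 {Atm : Type*} {Val : Type*} [Countable Atm] [Infinite Atm] [Finite Val] :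
    (∀ φ : PLC.Formula Atm Val, PLC.WPLC φ → PLC.MCM.Valid φ) ∧
      (∀ φ : PLC.Formula Atm Val, PLC.MCM.Valid φ → PLC.WPLC φ) :=
  ⟨fun _ h => h.valid, fun _ h => h.wplc⟩
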